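/- For real $x$ let $\{x\}=x-\lfloor x\rfloor$ be the fractional part, let $A(x)=\{1/x\}$ be the Gauss map and $A_0(x)=\lfloor \frac1x+1\rfloor-\frac1x$ the by-excess map. For irrational $x$ define the ($1$-periodic) Brjuno function, semi-Brjuno function and Wilton function by $$B(x)=\sum_{j=0}^\infty \Big(\prod_{i=0}^{j-1}A^i(\{x\})\Big)\log\frac1{A^j(\{x\})}\in[0,\infty],\qquad B_0(x)=\sum_{j=0}^\infty \Big(\prod_{i=0}^{j-1}A_0^i(\{x\})\Big)\log\frac1{A_0^j(\{x\})}\in[0,\infty],$$ $$W(x)=\sum_{j=0}^\infty(-1)^j \Big(\prod_{i=0}^{j-1}A^i(\{x\})\Big)\log\frac1{A^j(\{x\})},$$ the last being the limit in $[-\infty,\infty]$ of the partial sums, where it exists. Let $B_0^\pm(x)=\frac12\big(B_0(x)\pm B_0(-x)\big)$ be the even and odd parts of $B_0$. Then there are constants $C^+$ and $C^-$ such that $$|B(x)-2B_0^+(x)|\le C^+\qquad\text{and}\qquad |W(x)-2B_0^-(x)|\le C^-$$ for all irrational numbers $x$, the second for all irrational $x$ at which $B_0^-(x)$ is defined, i.e.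 $B_0(x)$ and $B_0(-x)$ are not both $\infty$ (the existence of $W(x)\in[-\infty,\infty]$ at these $x$ being part of the claim). Here the inequality between two extended real numbers means that either both are finite and differ by at most the constant, or both are equal to the same infinity; in particular $B(x)=\infty$ if and only if $B_0(x)=\infty$ or $B_0(-x)=\infty$. -/

import Mathlib

open scoped ENNReal
open Filter Topology

noncomputable section

/-- The Gauss map `A(x) = {1/x}`. -/
def gaussMap (x : ℝ) : ℝ := Int.fract (1 / x)

/-- The by-excess map `A₀(x) = ⌊1/x + 1⌋ - 1/x`. -/
def byExcessMap (x : ℝ) : ℝ := (⌊1 / x + 1⌋ : ℝ) - 1 / x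

/-- For a continued fraction map `T`, the `j`-th summand
`({x} T({x}) ⋯ T^{j-1}({x})) * log (1 / T^j({x}))`; for `j = 0` it is `log (1 / {x})`. -/
def cfTerm (T : ℝ → ℝ) (x : ℝ) (j : ℕ) : ℝ :=
  (∏ i ∈ Finset.range j, T^[i] (Int.fract x)) * Real.log (1 / T^[j] (Int.fract x))

/-- If `T` maps irrationals to irrationals in `(0,1)`, so do its iterates, from `{x}` on. -/
theorem iterate_mem_Ioo {T : ℝ → ℝ}
    (hT : ∀ y, Irrational y → Irrational (T y) ∧ T y ∈ Set.Ioo (0 : ℝ) 1)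
    {x : ℝ} (hx : Irrational x) (j : ℕ) :
    Irrational (T^[j] (Int.fract x)) ∧ T^[j] (Int.fract x) ∈ Set.Ioo (0 : ℝ) 1 := by
  have hf : Irrational (Int.fract x) := hx.sub_intCast ⌊x⌋
  cases j with
  | zero =>
    exact ⟨hf, lt_of_le_of_ne (Int.fract_nonneg x) (Ne.symm hf.ne_zero), Int.fract_lt_one x⟩
  | succ n =>
    rw [Function.iterate_succ_apply']
    refine hT _ ?_
    induction n with
    | zero => exact hf
    | succ k ih =>
      rw [Function.iterate_succ_apply']
      exact (hT _ ih).1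

theorem gaussMap_mem (y : ℝ) (hy : Irrational y) :
    Irrational (gaussMap y) ∧ gaussMap y ∈ Set.Ioo (0 : ℝ) 1 := by
  have hi : Irrational (gaussMap y) := by
    have h : Irrational (1 / y) := by simpa using hy.inv
    exact h.sub_intCast ⌊1 / y⌋
  exact ⟨hi, lt_of_le_of_ne (Int.fract_nonneg _) (Ne.symm hi.ne_zero), Int.fract_lt_one _⟩

theorem byExcessMap_mem (y : ℝ) (hy : Irrational y) :
    Irrational (byExcessMap y) ∧ byExcessMap y ∈ Set.Ioo (0 : ℝ) 1 := by
  have hi : Irrational (byExcessMap y) := by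
    have h : Irrational (1 / y) := by simpa using hy.inv
    exact h.intCast_sub _
  have h1 := Int.floor_le (1 / y + 1)
  have h2 := Int.lt_floor_add_one (1 / y + 1)
  refine ⟨hi, by unfold byExcessMap; linarith, lt_of_le_of_ne ?_ hi.ne_one⟩
  unfold byExcessMap; linarith

/-- The summands are nonnegative at irrational points, so that taking the sums of their images
under `ENNReal.ofReal` below truncates nothing. -/
theorem cfTerm_nonneg {T : ℝ → ℝ}
    (hT : ∀ y, Irrational y → Irrational (T y) ∧ T y ∈ Set.Ioo (0 : ℝ) 1)
    {x : ℝ} (hx : Irrational x) (j : ℕ) : 0 ≤ cfTerm T x j := by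
  refine mul_nonneg (Finset.prod_nonneg fun i _ => (iterate_mem_Ioo hT hx i).2.1.le)
    (Real.log_nonneg ?_)
  have h := (iterate_mem_Ioo hT hx j).2
  exact (one_le_div h.1).2 h.2.le

/-- The Brjuno function `B`, with values in `[0,∞]` (at irrational points). -/
def brjuno (x : ℝ) : ℝ≥0∞ := ∑' j : ℕ, ENNReal.ofReal (cfTerm gaussMap x j)

/-- The semi-Brjuno function `B₀`, with values in `[0,∞]` (at irrational points). -/
def semiBrjuno (x : ℝ) : ℝ≥0∞ := ∑' j : ℕ, ENNReal.ofReal (cfTerm byExcessMap x j)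

/-- The even part `B₀⁺(x) = (B₀(x) + B₀(-x)) / 2`. -/
def semiBrjunoEven (x : ℝ) : EReal :=
  ((semiBrjuno x : EReal) + (semiBrjuno (-x) : EReal)) / 2

/-- The odd part `B₀⁻(x) = (B₀(x) - B₀(-x)) / 2`; meaningful unless `B₀(x) = B₀(-x) = ∞`. -/
def semiBrjunoOdd (x : ℝ) : EReal :=
  ((semiBrjuno x : EReal) - (semiBrjuno (-x) : EReal)) / 2

/-- The partial sums of the Wilton series
`∑ (-1)^j ({x} A({x}) ⋯ A^{j-1}({x})) * log (1 / A^j({x}))`. -/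
def wiltonPartialSum (x : ℝ) (n : ℕ) : ℝ :=
  ∑ j ∈ Finset.range n, (-1 : ℝ) ^ j * cfTerm gaussMap x j

/-- `W(x) = w`: the Wilton series at `x` has the sum `w ∈ [-∞,∞]`, as the limit of its
partial sums. -/
def IsWiltonValue (x : ℝ) (w : EReal) : Prop :=
  Tendsto (fun n => ((wiltonPartialSum x n : ℝ) : EReal)) atTop (𝓝 w)

/-- `|a - b| ≤ C` for extended reals: either both are finite and differ by at most `C`,
or they are the same infinity. -/
def DistLE (a b : EReal) (C : ℝ) : Prop :=
  (∃ r s : ℝ, a = r ∧ b = s ∧ |r - s| ≤ C) ∨ (a = ⊤ ∧ b = ⊤) ∨ (a = ⊥ ∧ b = ⊥)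

end

/-! By periodicity let `x` lie in `(0,1)`, so that `B₀(-x) = B₀(1 - x)`. Since `A₀ = 1 - A`, one
by-excess step gives `B₀(x) = log (1/x) + x B₀(1 - A x)`. Following the by-excess orbit of `1 - x`
through a whole Gauss digit gives `B₀(1 - x) = d(x) + x B₀(A x)` with `0 ≤ d ≤ 2`
(`semiBrjuno_one_sub_gauss_rec`, `defect_le`).

Alternating the two recursions, `B₀(x)` collects the even Brjuno terms and the odd defect terms,
`B₀(1 - x)` the others (`semiBrjuno_eq`, `semiBrjuno_one_sub_eq`). Their sum is `B` and their
difference is `W`, up to defect terms of total at most 8 (`tsum_defectTerm_le`). -/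

theorem cfTerm_succ {T : ℝ → ℝ} {x : ℝ} (hx : x ∈ Set.Ioo (0 : ℝ) 1)
    (hT : T x ∈ Set.Ioo (0 : ℝ) 1) (j : ℕ) : cfTerm T x (j + 1) = x * cfTerm T (T x) j := by
  have h1 : Int.fract x = x := Int.fract_eq_self.2 ⟨hx.1.le, hx.2⟩
  have h2 : Int.fract (T x) = T x := Int.fract_eq_self.2 ⟨hT.1.le, hT.2⟩
  simp only [cfTerm, h1, h2, Finset.prod_range_succ', Function.iterate_succ_apply,
    Function.iterate_zero, id]
  ring

theorem cfTerm_zero {T : ℝ → ℝ} {x : ℝ} (hx : x ∈ Set.Ioo (0 : ℝ) 1) :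
    cfTerm T x 0 = Real.log (1 / x) := by
  simp [cfTerm, Int.fract_eq_self.2 ⟨hx.1.le, hx.2⟩]

/-- `x` is an irrational number of the open unit interval. -/
def UnitIrrational (x : ℝ) : Prop := Irrational x ∧ x ∈ Set.Ioo (0 : ℝ) 1

theorem UnitIrrational.gauss {x : ℝ} (hx : UnitIrrational x) : UnitIrrational (gaussMap x) :=
  gaussMap_mem x hx.1

theorem UnitIrrational.byExcess {x : ℝ} (hx : UnitIrrational x) :
    UnitIrrational (byExcessMap x) :=
  byExcessMap_mem x hx.1

theorem UnitIrrational.one_sub {x : ℝ} (hx : UnitIrrational x) : UnitIrrational (1 - x) :=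
  ⟨by simpa using hx.1.intCast_sub 1, by linarith [hx.2.2], by linarith [hx.2.1]⟩

theorem unitIrrational_fract {x : ℝ} (hx : Irrational x) : UnitIrrational (Int.fract x) := by
  simpa [UnitIrrational] using iterate_mem_Ioo gaussMap_mem hx 0

theorem byExcessMap_eq (x : ℝ) : byExcessMap x = 1 - gaussMap x := by
  simp only [byExcessMap, gaussMap, Int.floor_add_one, Int.fract]
  push_cast
  ring

/-! ### The defect -/

/-- The defect `B₀(1 - x) - x B₀(A x)` at `x = 1 / (n + 1 + y)`. -/
noncomputable def defectAux : ℕ → ℝ → ℝ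
  | 0, y => Real.log (1 + y) - y / (1 + y) * Real.log y
  | n + 1, y => Real.log ((n + 2 + y) / (n + 1 + y)) + (n + 1 + y) / (n + 2 + y) * defectAux n y

theorem defectAux_nonneg (n : ℕ) {y : ℝ} (hy : y ∈ Set.Ioo (0 : ℝ) 1) : 0 ≤ defectAux n y := by
  obtain ⟨h0, h1⟩ := hy
  induction n with
  | zero =>
    have h2 : 0 ≤ Real.log (1 + y) := Real.log_nonneg (by linarith)
    have h3 : Real.log y ≤ 0 := Real.log_nonpos h0.le h1.le
    have h4 : 0 ≤ y / (1 + y) := by positivity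
    simp only [defectAux]
    nlinarith
  | succ n ih =>
    have h2 : 0 ≤ Real.log ((n + 2 + y) / (n + 1 + y)) :=
      Real.log_nonneg ((one_le_div (by positivity)).2 (by linarith))
    simp only [defectAux]
    positivity

/-- The factor `n + 1 + y` makes the recursion telescope: the initial value is at most `1 + y² ≤ 2`,
and each increment at most `(n + 2 + y) / (n + 1 + y) ≤ 2`. -/
theorem mul_defectAux_le (n : ℕ) {y : ℝ} (hy : y ∈ Set.Ioo (0 : ℝ) 1) :
    (n + 1 + y) * defectAux n y ≤ 2 * (n + 1) := by
  obtain ⟨h0, h1⟩ := hy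
  induction n with
  | zero =>
    have h2 : Real.log (1 + y) ≤ y := by
      linarith [Real.log_le_sub_one_of_pos (show 0 < 1 + y by linarith)]
    have h3 : 1 - y⁻¹ ≤ Real.log y := Real.one_sub_inv_le_log_of_pos h0
    have h4 : y * (1 - y⁻¹) = y - 1 := by field_simp
    have h5 := mul_le_mul_of_nonneg_left h3 h0.le
    have h6 : ((0 : ℕ) + 1 + y) * defectAux 0 y =
        (1 + y) * Real.log (1 + y) - y * Real.log y := by
      simp only [defectAux]
      field_simp
      push_cast
      ring
    rw [h6]
    push_cast
    nlinarith
  | succ n ih =>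
    have h2 : Real.log ((n + 2 + y) / (n + 1 + y)) ≤ 1 / (n + 1 + y) := by
      refine (Real.log_le_sub_one_of_pos (by positivity)).trans (le_of_eq ?_)
      field_simp
      ring
    have h3 : (((n + 1 : ℕ) : ℝ) + 1 + y) * defectAux (n + 1) y =
        (n + 2 + y) * Real.log ((n + 2 + y) / (n + 1 + y)) + (n + 1 + y) * defectAux n y := by
      simp only [defectAux]
      field_simp
      push_cast
      ring
    have h4 : (n + 2 + y) * (1 / (n + 1 + y)) ≤ 2 := by
      rw [mul_one_div, div_le_iff₀ (by positivity)]
      linarith [(Nat.cast_nonneg n : (0 : ℝ) ≤ n)]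
    have h5 := mul_le_mul_of_nonneg_left h2 (show (0 : ℝ) ≤ n + 2 + y by positivity)
    rw [h3]
    push_cast
    linarith

theorem defectAux_le (n : ℕ) {y : ℝ} (hy : y ∈ Set.Ioo (0 : ℝ) 1) : defectAux n y ≤ 2 := by
  have h := mul_defectAux_le n hy
  have h0 := hy.1
  have h1 : (0 : ℝ) < n + 1 + y := by positivity
  by_contra! h2
  nlinarith

/-- The defect `B₀(1 - x) - x B₀(A x)`. -/
noncomputable def defect (x : ℝ) : ℝ := defectAux (⌊1 / x⌋₊ - 1) (gaussMap x)

theorem UnitIrrational.defect_nonneg {x : ℝ} (hx : UnitIrrational x) : 0 ≤ defect x :=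
  defectAux_nonneg _ hx.gauss.2

theorem UnitIrrational.defect_le {x : ℝ} (hx : UnitIrrational x) : defect x ≤ 2 :=
  defectAux_le _ hx.gauss.2

/-- The dual of the by-excess map under `x ↦ 1 - x`. -/
noncomputable def dualMap (x : ℝ) : ℝ := 1 - byExcessMap (1 - x)

theorem UnitIrrational.dual {x : ℝ} (hx : UnitIrrational x) : UnitIrrational (dualMap x) :=
  hx.one_sub.byExcess.one_sub

theorem UnitIrrational.gaussMap_of_half_lt {x : ℝ} (hx : UnitIrrational x) (h : 1 / 2 < x) :
    gaussMap x = 1 / x - 1 ∧ ⌊1 / x⌋₊ = 1 := by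
  have h0 := hx.2.1
  have h1 := hx.2.2
  have h2 : 1 < 1 / x := (one_lt_div h0).2 h1
  have h3 : 1 / x < 2 := by rw [div_lt_iff₀ h0]; linarith
  have h4 : ⌊1 / x⌋ = 1 := Int.floor_eq_iff.2 ⟨by push_cast; linarith, by push_cast; linarith⟩
  refine ⟨by rw [gaussMap, Int.fract, h4, Int.cast_one], ?_⟩
  exact (Nat.floor_eq_iff (by linarith)).2 ⟨by push_cast; linarith, by push_cast; linarith⟩

theorem UnitIrrational.dualMap_of_lt_half {x : ℝ} (hx : UnitIrrational x) (h : x < 1 / 2) :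
    dualMap x = x / (1 - x) := by
  have h0 := hx.2.1
  rw [dualMap, byExcessMap_eq, (hx.one_sub.gaussMap_of_half_lt (by linarith)).1]
  have : 1 - x ≠ 0 := by linarith
  field_simp
  ring

theorem gaussMap_inv_sub_one {x y : ℝ} (h : 1 / y = 1 / x - 1) : gaussMap y = gaussMap x := by
  simp [gaussMap, h]

/-- Here `A x = (1 - x) / x`, whose reciprocal is `1 / (1 - x) - 1`; hence `A (A x) = A (1 - x)`. -/
theorem UnitIrrational.dualMap_of_half_lt {x : ℝ} (hx : UnitIrrational x) (h : 1 / 2 < x) :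
    dualMap x = gaussMap (gaussMap x) := by
  have h0 := hx.2.1
  have h1 : 1 - x ≠ 0 := by linarith [hx.2.2]
  have h2 : 1 / x - 1 ≠ 0 := by
    have : 1 / x - 1 = (1 - x) / x := by field_simp
    rw [this]
    positivity
  rw [dualMap, byExcessMap_eq, (hx.gaussMap_of_half_lt h).1, sub_sub_cancel]
  refine (gaussMap_inv_sub_one ?_).symm
  field_simp
  ring

theorem UnitIrrational.inv_dualMap {x : ℝ} (hx : UnitIrrational x) (h : x < 1 / 2) :
    1 / dualMap x = 1 / x - 1 := by
  have h0 := hx.2.1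
  rw [hx.dualMap_of_lt_half h]
  field_simp

theorem UnitIrrational.gaussMap_dualMap {x : ℝ} (hx : UnitIrrational x) (h : x < 1 / 2) :
    gaussMap (dualMap x) = gaussMap x :=
  gaussMap_inv_sub_one (hx.inv_dualMap h)

theorem UnitIrrational.floor_dualMap {x : ℝ} (hx : UnitIrrational x) (h : x < 1 / 2) :
    ⌊1 / dualMap x⌋₊ + 1 = ⌊1 / x⌋₊ := by
  have h0 := hx.2.1
  have h2 : 2 < 1 / x := by rw [lt_div_iff₀ h0]; linarith
  rw [← Nat.floor_add_one (by rw [hx.inv_dualMap h]; linarith), hx.inv_dualMap h]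
  simp

/-- This is the successor clause of `defectAux`: the dual map keeps `A x` and lowers the first digit
by one. -/
theorem UnitIrrational.defect_of_lt_half {x : ℝ} (hx : UnitIrrational x) (h : x < 1 / 2) :
    defect x = Real.log (1 / (1 - x)) + (1 - x) * defect (dualMap x) := by
  have h0 := hx.2.1
  have h1 := hx.gauss.2.1
  obtain ⟨n, hn⟩ : ∃ n : ℕ, ⌊1 / x⌋₊ = n + 2 := by
    refine ⟨⌊1 / x⌋₊ - 2, ?_⟩
    have : 2 ≤ ⌊1 / x⌋₊ := Nat.le_floor (by rw [le_div_iff₀ h0]; push_cast; linarith)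
    omega
  have hn' : ⌊1 / dualMap x⌋₊ = n + 1 := by have := hx.floor_dualMap h; omega
  have hg : 1 / x = n + 2 + gaussMap x := by
    have h3 : ((⌊1 / x⌋₊ : ℕ) : ℝ) = (⌊1 / x⌋ : ℝ) := natCast_floor_eq_intCast_floor (by positivity)
    rw [hn] at h3
    rw [gaussMap, Int.fract, ← h3]
    push_cast
    ring
  rw [defect, defect, hx.gaussMap_dualMap h, hn, hn']
  have hx' : x = 1 / (n + 2 + gaussMap x) := by rw [← hg]; simp
  have h1x : 1 - x = (n + 1 + gaussMap x) / (n + 2 + gaussMap x) := by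
    rw [eq_div_iff (by positivity), sub_mul, ← hg]
    field_simp
    rw [← sub_eq_zero]
    field_simp at hg
    linarith
  rw [show n + 2 - 1 = n + 1 from rfl, show n + 1 - 1 = n from rfl, defectAux, h1x, one_div_div]

theorem UnitIrrational.defect_of_half_lt {x : ℝ} (hx : UnitIrrational x) (h : 1 / 2 < x) :
    defect x + x * Real.log (1 / gaussMap x) = Real.log (1 / (1 - x)) := by
  have h0 := hx.2.1
  have h1 : 0 < 1 - x := by linarith [hx.2.2]
  obtain ⟨hg, hf⟩ := hx.gaussMap_of_half_lt h
  have hy : gaussMap x = (1 - x) / x := by rw [hg]; field_simp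
  rw [defect, hf, hy, show 1 - 1 = 0 from rfl, defectAux]
  have h2 : 1 + (1 - x) / x = 1 / x := by field_simp; ring
  have h3 : (1 - x) / x / (1 / x) = 1 - x := by field_simp
  rw [h2, h3, one_div, one_div, one_div, Real.log_inv, Real.log_inv, Real.log_inv,
    Real.log_div h1.ne' h0.ne']
  ring

/-! ### Pairs of functions satisfying the Gauss recursion -/

theorem UnitIrrational.lt_or_lt_half {x : ℝ} (hx : UnitIrrational x) : x < 1 / 2 ∨ 1 / 2 < x := by
  refine lt_or_gt_of_ne fun h => hx.1 ⟨1 / 2, ?_⟩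
  rw [h]
  norm_num

theorem UnitIrrational.mul_gaussMap {x : ℝ} (hx : UnitIrrational x) (h : 1 / 2 < x) :
    x * gaussMap x = 1 - x := by
  have h0 := hx.2.1
  rw [(hx.gaussMap_of_half_lt h).1]
  field_simp

/-- `log (1 / x)` as an extended nonnegative real. -/
noncomputable def logInv (x : ℝ) : ℝ≥0∞ := ENNReal.ofReal (Real.log (1 / x))

theorem UnitIrrational.log_nonneg {x : ℝ} (hx : UnitIrrational x) : 0 ≤ Real.log (1 / x) :=
  Real.log_nonneg ((one_le_div hx.2.1).2 hx.2.2.le)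

theorem UnitIrrational.mul_dualMap {x : ℝ} (hx : UnitIrrational x) (h : x < 1 / 2) :
    (1 - x) * dualMap x = x := by
  rw [hx.dualMap_of_lt_half h]
  have : 1 - x ≠ 0 := by linarith
  field_simp

theorem UnitIrrational.ofReal_one_sub_mul_dualMap {x : ℝ} (hx : UnitIrrational x) (h : x < 1 / 2) :
    ENNReal.ofReal (1 - x) * ENNReal.ofReal (dualMap x) = ENNReal.ofReal x := by
  rw [← ENNReal.ofReal_mul hx.one_sub.2.1.le, hx.mul_dualMap h]

theorem UnitIrrational.ofReal_defect_of_lt_half {x : ℝ} (hx : UnitIrrational x) (h : x < 1 / 2) :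
    ENNReal.ofReal (defect x) =
      logInv (1 - x) + ENNReal.ofReal (1 - x) * ENNReal.ofReal (defect (dualMap x)) := by
  rw [hx.defect_of_lt_half h, ENNReal.ofReal_add hx.one_sub.log_nonneg
    (mul_nonneg hx.one_sub.2.1.le hx.dual.defect_nonneg), ENNReal.ofReal_mul hx.one_sub.2.1.le,
    logInv]

theorem UnitIrrational.ofReal_defect_of_half_lt {x : ℝ} (hx : UnitIrrational x) (h : 1 / 2 < x) :
    ENNReal.ofReal (defect x) + ENNReal.ofReal x * logInv (gaussMap x) = logInv (1 - x) := by
  rw [logInv, logInv, ← hx.defect_of_half_lt h, ENNReal.ofReal_add hx.defect_nonneg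
    (mul_nonneg hx.2.1.le hx.gauss.log_nonneg), ENNReal.ofReal_mul hx.2.1.le]

/-- The Gauss recursion for a pair of functions implies the dual by-excess recursion. -/
theorem dual_rec_of_gauss_rec {P Q : ℝ → ℝ≥0∞}
    (hP : ∀ x, UnitIrrational x → P x = logInv x + ENNReal.ofReal x * Q (gaussMap x))
    (hQ : ∀ x, UnitIrrational x →
      Q x = ENNReal.ofReal (defect x) + ENNReal.ofReal x * P (gaussMap x))
    {x : ℝ} (hx : UnitIrrational x) :
    Q x = logInv (1 - x) + ENNReal.ofReal (1 - x) * Q (dualMap x) := by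
  rcases hx.lt_or_lt_half with h | h
  -- `x` and `dualMap x` have the same Gauss image, and `(1 - x) * dualMap x = x` matches the
  -- coefficients of `P`.
  · rw [hQ x hx, hQ _ hx.dual, hx.gaussMap_dualMap h, hx.ofReal_defect_of_lt_half h, mul_add,
      ← mul_assoc, hx.ofReal_one_sub_mul_dualMap h, add_assoc]
  -- One dual step is two Gauss steps, with `x * gaussMap x = 1 - x`.
  · rw [hQ x hx, hP _ hx.gauss, mul_add, ← add_assoc, hx.ofReal_defect_of_half_lt h, ← mul_assoc,
      ← ENNReal.ofReal_mul hx.2.1.le, hx.mul_gaussMap h, hx.dualMap_of_half_lt h]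

/-- The dual by-excess recursion implies the Gauss recursion. -/
theorem gauss_rec_of_dual_rec {P Q : ℝ → ℝ≥0∞}
    (hP : ∀ x, UnitIrrational x → P x = logInv x + ENNReal.ofReal x * Q (gaussMap x))
    (hQ : ∀ x, UnitIrrational x →
      Q x = logInv (1 - x) + ENNReal.ofReal (1 - x) * Q (dualMap x))
    {x : ℝ} (hx : UnitIrrational x) :
    Q x = ENNReal.ofReal (defect x) + ENNReal.ofReal x * P (gaussMap x) := by
  -- Induction on the first digit: dual steps lower it by one until it is 1, that is, `1 / 2 < x`.
  induction hn : ⌊1 / x⌋₊ generalizing x with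
  | zero =>
    have : 1 ≤ ⌊1 / x⌋₊ := Nat.le_floor (by
      rw [Nat.cast_one]; exact (one_le_div hx.2.1).2 hx.2.2.le)
    omega
  | succ n ih =>
    rcases hx.lt_or_lt_half with h | h
    · rw [hQ x hx, ih hx.dual (by have := hx.floor_dualMap h; omega), hx.gaussMap_dualMap h,
        hx.ofReal_defect_of_lt_half h, mul_add, ← mul_assoc,
        hx.ofReal_one_sub_mul_dualMap h, add_assoc]
    · rw [hQ x hx, hP _ hx.gauss, mul_add, ← add_assoc, hx.ofReal_defect_of_half_lt h,
        ← mul_assoc, ← ENNReal.ofReal_mul hx.2.1.le, hx.mul_gaussMap h, hx.dualMap_of_half_lt h]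

/-! ### The recursions for the semi-Brjuno function -/

/-- Partial sums of the semi-Brjuno series. -/
noncomputable def semiBrjunoPartial (n : ℕ) (x : ℝ) : ℝ≥0∞ :=
  ∑ j ∈ Finset.range n, ENNReal.ofReal (cfTerm byExcessMap x j)

theorem UnitIrrational.semiBrjunoPartial_succ {x : ℝ} (hx : UnitIrrational x) (n : ℕ) :
    semiBrjunoPartial (n + 1) x =
      logInv x + ENNReal.ofReal x * semiBrjunoPartial n (byExcessMap x) := by
  simp only [semiBrjunoPartial]
  rw [Finset.sum_range_succ', cfTerm_zero hx.2, add_comm, Finset.mul_sum, logInv]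
  simp only [cfTerm_succ hx.2 hx.byExcess.2, ENNReal.ofReal_mul hx.2.1.le]

theorem UnitIrrational.semiBrjuno_rec {x : ℝ} (hx : UnitIrrational x) :
    semiBrjuno x = logInv x + ENNReal.ofReal x * semiBrjuno (byExcessMap x) := by
  simp only [semiBrjuno]
  rw [tsum_eq_zero_add' ENNReal.summable, cfTerm_zero hx.2, ← ENNReal.tsum_mul_left, logInv]
  simp only [cfTerm_succ hx.2 hx.byExcess.2, ENNReal.ofReal_mul hx.2.1.le]

theorem UnitIrrational.semiBrjuno_gauss_rec {x : ℝ} (hx : UnitIrrational x) :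
    semiBrjuno x = logInv x + ENNReal.ofReal x * semiBrjuno (1 - gaussMap x) := by
  rw [hx.semiBrjuno_rec, byExcessMap_eq]

theorem UnitIrrational.semiBrjuno_one_sub_gauss_rec {x : ℝ} (hx : UnitIrrational x) :
    semiBrjuno (1 - x) =
      ENNReal.ofReal (defect x) + ENNReal.ofReal x * semiBrjuno (gaussMap x) := by
  refine gauss_rec_of_dual_rec (P := semiBrjuno) (Q := fun x => semiBrjuno (1 - x))
    (fun x hx => hx.semiBrjuno_gauss_rec) (fun x hx => ?_) hx
  rw [hx.one_sub.semiBrjuno_rec, dualMap, sub_sub_cancel]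

/-! ### The alternating series -/

/-- The product `{x} A({x}) ⋯ A^{j-1}({x})`. -/
noncomputable def gaussProd (x : ℝ) (j : ℕ) : ℝ := ∏ i ∈ Finset.range j, gaussMap^[i] (Int.fract x)

/-- The summands of the series of defects. -/
noncomputable def defectTerm (x : ℝ) (j : ℕ) : ℝ :=
  gaussProd x j * defect (gaussMap^[j] (Int.fract x))

theorem UnitIrrational.gaussProd_succ {x : ℝ} (hx : UnitIrrational x) (j : ℕ) :
    gaussProd x (j + 1) = x * gaussProd (gaussMap x) j := by
  have h1 : Int.fract x = x := Int.fract_eq_self.2 ⟨hx.2.1.le, hx.2.2⟩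
  have h2 : Int.fract (gaussMap x) = gaussMap x :=
    Int.fract_eq_self.2 ⟨hx.gauss.2.1.le, hx.gauss.2.2⟩
  simp only [gaussProd, h1, h2, Finset.prod_range_succ', Function.iterate_succ_apply,
    Function.iterate_zero, id]
  ring

theorem UnitIrrational.defectTerm_succ {x : ℝ} (hx : UnitIrrational x) (j : ℕ) :
    defectTerm x (j + 1) = x * defectTerm (gaussMap x) j := by
  have h1 : Int.fract x = x := Int.fract_eq_self.2 ⟨hx.2.1.le, hx.2.2⟩
  have h2 : Int.fract (gaussMap x) = gaussMap x :=
    Int.fract_eq_self.2 ⟨hx.gauss.2.1.le, hx.gauss.2.2⟩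
  simp only [defectTerm, hx.gaussProd_succ, h1, h2, Function.iterate_succ_apply]
  ring

theorem UnitIrrational.defectTerm_zero {x : ℝ} (hx : UnitIrrational x) :
    defectTerm x 0 = defect x := by
  simp [defectTerm, gaussProd, Int.fract_eq_self.2 ⟨hx.2.1.le, hx.2.2⟩]

theorem gaussProd_nonneg {x : ℝ} (hx : Irrational x) (j : ℕ) : 0 ≤ gaussProd x j :=
  Finset.prod_nonneg fun i _ => (iterate_mem_Ioo gaussMap_mem hx i).2.1.le

/-! ### Bounding the total defect -/

theorem UnitIrrational.mul_gaussMap_le_half {x : ℝ} (hx : UnitIrrational x) :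
    x * gaussMap x ≤ 1 / 2 := by
  rcases hx.lt_or_lt_half with h | h
  · nlinarith [hx.gauss.2.2, hx.gauss.2.1, hx.2.1]
  · rw [hx.mul_gaussMap h]
    linarith

/-- Two Gauss steps contribute a factor at most `1/2`, so a bound `S` passes to `1 + x + S/2 ≤ 2 +
S/2`, which preserves `S = 4`. -/
theorem UnitIrrational.sum_gaussProd_le {x : ℝ} (hx : UnitIrrational x) (n : ℕ) :
    ∑ j ∈ Finset.range n, gaussProd x j ≤ 4 := by
  induction n using Nat.twoStepInduction generalizing x with
  | zero => simp
  | one => simp [gaussProd]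
  | more n ih _ =>
    have h0 : ∀ y, gaussProd y 0 = 1 := fun y => by simp [gaussProd]
    have h : ∑ j ∈ Finset.range (n + 2), gaussProd x j =
        x * gaussMap x * ∑ j ∈ Finset.range n, gaussProd (gaussMap (gaussMap x)) j + x + 1 := by
      rw [Finset.sum_range_succ', Finset.sum_range_succ', Finset.mul_sum]
      simp only [hx.gaussProd_succ, hx.gauss.gaussProd_succ, h0, mul_assoc, mul_one]
    have h1 := ih hx.gauss.gauss
    have h2 := hx.mul_gaussMap_le_half
    have h3 : 0 ≤ x * gaussMap x := mul_nonneg hx.2.1.le hx.gauss.2.1.le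
    rw [h]
    nlinarith [hx.2.2]

theorem defectTerm_nonneg {x : ℝ} (hx : Irrational x) (j : ℕ) : 0 ≤ defectTerm x j :=
  mul_nonneg (gaussProd_nonneg hx j)
    (UnitIrrational.defect_nonneg (iterate_mem_Ioo gaussMap_mem hx j))

theorem UnitIrrational.tsum_defectTerm_le {x : ℝ} (hx : UnitIrrational x) :
    ∑' j, ENNReal.ofReal (defectTerm x j) ≤ ENNReal.ofReal 8 := by
  refine ENNReal.tsum_le_of_sum_range_le fun n => ?_
  rw [← ENNReal.ofReal_sum_of_nonneg fun j _ => defectTerm_nonneg hx.1 j]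
  refine ENNReal.ofReal_le_ofReal ?_
  calc ∑ j ∈ Finset.range n, defectTerm x j
      ≤ ∑ j ∈ Finset.range n, gaussProd x j * 2 := Finset.sum_le_sum fun j _ =>
        mul_le_mul_of_nonneg_left
          (UnitIrrational.defect_le (iterate_mem_Ioo gaussMap_mem hx.1 j)) (gaussProd_nonneg hx.1 j)
    _ ≤ 8 := by rw [← Finset.sum_mul]; linarith [hx.sum_gaussProd_le n]

/-- The terms of the Brjuno series at indices of parity `p`, and of the series of defects at the
others. -/
noncomputable def mixedTerm (p : Bool) (x : ℝ) (j : ℕ) : ℝ :=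
  if j.bodd = p then cfTerm gaussMap x j else defectTerm x j

theorem UnitIrrational.mixedTerm_succ {x : ℝ} (hx : UnitIrrational x) (p : Bool) (j : ℕ) :
    mixedTerm p x (j + 1) = x * mixedTerm (!p) (gaussMap x) j := by
  simp only [mixedTerm, cfTerm_succ hx.2 hx.gauss.2, hx.defectTerm_succ, Nat.bodd_succ]
  cases p <;> cases j.bodd <;> simp

/-- The sum of the mixed series. -/
noncomputable def mixedSum (p : Bool) (x : ℝ) : ℝ≥0∞ := ∑' j, ENNReal.ofReal (mixedTerm p x j)

theorem UnitIrrational.mixedSum_false {x : ℝ} (hx : UnitIrrational x) :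
    mixedSum false x = logInv x + ENNReal.ofReal x * mixedSum true (gaussMap x) := by
  simp only [mixedSum]
  rw [tsum_eq_zero_add' ENNReal.summable, ← ENNReal.tsum_mul_left, logInv, ← cfTerm_zero hx.2]
  simp only [hx.mixedTerm_succ, ENNReal.ofReal_mul hx.2.1.le]
  rfl

theorem UnitIrrational.mixedSum_true {x : ℝ} (hx : UnitIrrational x) :
    mixedSum true x =
      ENNReal.ofReal (defect x) + ENNReal.ofReal x * mixedSum false (gaussMap x) := by
  simp only [mixedSum]
  rw [tsum_eq_zero_add' ENNReal.summable, ← ENNReal.tsum_mul_left, ← hx.defectTerm_zero]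
  simp only [hx.mixedTerm_succ, ENNReal.ofReal_mul hx.2.1.le]
  rfl

/-! ### Identifying the semi-Brjuno function with the mixed series -/

/-- Values may be infinite, so the common recursion alone does not give equality; partial sums are
compared in both directions. Here the mixed sums obey the by-excess recursions. -/
theorem UnitIrrational.semiBrjunoPartial_le {x : ℝ} (hx : UnitIrrational x) (n : ℕ) :
    semiBrjunoPartial n x ≤ mixedSum false x ∧ semiBrjunoPartial n (1 - x) ≤ mixedSum true x := by
  induction n generalizing x with
  | zero => simp [semiBrjunoPartial]
  | succ n ih =>
    rw [hx.semiBrjunoPartial_succ, hx.one_sub.semiBrjunoPartial_succ, hx.mixedSum_false,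
      dual_rec_of_gauss_rec (fun x hx => hx.mixedSum_false) (fun x hx => hx.mixedSum_true) hx,
      byExcessMap_eq x]
    have h := (ih hx.dual).2
    rw [dualMap, sub_sub_cancel] at h
    exact ⟨by gcongr; exact (ih hx.gauss).2, by gcongr; exact h⟩

/-- The converse comparison uses the Gauss recursions of `semiBrjuno`. -/
theorem UnitIrrational.sum_mixedTerm_le {x : ℝ} (hx : UnitIrrational x) (n : ℕ) :
    ∑ j ∈ Finset.range n, ENNReal.ofReal (mixedTerm false x j) ≤ semiBrjuno x ∧
      ∑ j ∈ Finset.range n, ENNReal.ofReal (mixedTerm true x j) ≤ semiBrjuno (1 - x) := by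
  induction n generalizing x with
  | zero => simp
  | succ n ih =>
    rw [hx.semiBrjuno_gauss_rec, hx.semiBrjuno_one_sub_gauss_rec, Finset.sum_range_succ',
      Finset.sum_range_succ']
    simp only [hx.mixedTerm_succ, ENNReal.ofReal_mul hx.2.1.le, ← Finset.mul_sum]
    rw [add_comm, add_comm _ (ENNReal.ofReal (mixedTerm true x 0))]
    have h1 : ENNReal.ofReal (mixedTerm false x 0) = logInv x := by
      rw [logInv, ← cfTerm_zero hx.2]
      rfl
    have h2 : ENNReal.ofReal (mixedTerm true x 0) = ENNReal.ofReal (defect x) := by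
      rw [← hx.defectTerm_zero]
      rfl
    rw [h1, h2]
    exact ⟨by gcongr; exact (ih hx.gauss).2, by gcongr; exact (ih hx.gauss).1⟩

theorem UnitIrrational.semiBrjuno_eq {x : ℝ} (hx : UnitIrrational x) :
    semiBrjuno x = mixedSum false x :=
  le_antisymm (ENNReal.tsum_le_of_sum_range_le fun n => (hx.semiBrjunoPartial_le n).1)
    (ENNReal.tsum_le_of_sum_range_le fun n => (hx.sum_mixedTerm_le n).1)

theorem UnitIrrational.semiBrjuno_one_sub_eq {x : ℝ} (hx : UnitIrrational x) :
    semiBrjuno (1 - x) = mixedSum true x :=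
  le_antisymm (ENNReal.tsum_le_of_sum_range_le fun n => (hx.semiBrjunoPartial_le n).2)
    (ENNReal.tsum_le_of_sum_range_le fun n => (hx.sum_mixedTerm_le n).2)

/-- The part of the Brjuno series over the indices of parity `p`. -/
noncomputable def brjunoPart (p : Bool) (x : ℝ) : ℝ≥0∞ :=
  ∑' j, ENNReal.ofReal (if j.bodd = p then cfTerm gaussMap x j else 0)

/-- The part of the series of defects over the indices of parity `p`. -/
noncomputable def defectPart (p : Bool) (x : ℝ) : ℝ≥0∞ :=
  ∑' j, ENNReal.ofReal (if j.bodd = p then defectTerm x j else 0)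

theorem mixedSum_eq (p : Bool) (x : ℝ) :
    mixedSum p x = brjunoPart p x + defectPart (!p) x := by
  rw [mixedSum, brjunoPart, defectPart, ← ENNReal.tsum_add]
  refine tsum_congr fun j => ?_
  rw [mixedTerm]
  cases p <;> cases j.bodd <;> simp

theorem brjuno_eq_add (x : ℝ) : brjuno x = brjunoPart false x + brjunoPart true x := by
  rw [brjuno, brjunoPart, brjunoPart, ← ENNReal.tsum_add]
  refine tsum_congr fun j => ?_
  cases j.bodd <;> simp

theorem UnitIrrational.defectPart_add_le {x : ℝ} (hx : UnitIrrational x) :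
    defectPart false x + defectPart true x ≤ ENNReal.ofReal 8 := by
  refine le_trans (le_of_eq ?_) hx.tsum_defectTerm_le
  rw [defectPart, defectPart, ← ENNReal.tsum_add]
  refine tsum_congr fun j => ?_
  cases j.bodd <;> simp

/-! ### Periodicity, the Wilton limit and the final comparison -/

theorem cfTerm_fract (T : ℝ → ℝ) (x : ℝ) (j : ℕ) : cfTerm T (Int.fract x) j = cfTerm T x j := by
  simp [cfTerm]

theorem brjuno_fract (x : ℝ) : brjuno (Int.fract x) = brjuno x := by
  simp [brjuno, cfTerm_fract]

theorem semiBrjuno_fract (x : ℝ) : semiBrjuno (Int.fract x) = semiBrjuno x := by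
  simp [semiBrjuno, cfTerm_fract]

theorem semiBrjuno_neg {x : ℝ} (hx : Irrational x) :
    semiBrjuno (-x) = semiBrjuno (1 - Int.fract x) := by
  rw [← semiBrjuno_fract (-x), Int.fract_neg (unitIrrational_fract hx).2.1.ne']

theorem two_mul_div_two (a : EReal) : 2 * (a / 2) = a :=
  EReal.mul_div_cancel (by decide) (by decide) (by norm_num)

theorem tendsto_partialSum_brjunoPart (p : Bool) {x : ℝ} (hx : Irrational x) :
    Tendsto (fun n => ((∑ j ∈ Finset.range n, if j.bodd = p then cfTerm gaussMap x j else 0 : ℝ) :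
      EReal)) atTop (𝓝 (brjunoPart p x : EReal)) := by
  have h := (continuous_coe_ennreal_ereal.tendsto _).comp
    (ENNReal.tendsto_nat_tsum fun j : ℕ =>
      ENNReal.ofReal (if j.bodd = p then cfTerm gaussMap x j else 0))
  refine h.congr fun n => ?_
  have h0 : ∀ j : ℕ, 0 ≤ if j.bodd = p then cfTerm gaussMap x j else 0 := fun j => by
    split_ifs
    exacts [cfTerm_nonneg gaussMap_mem hx j, le_rfl]
  simp only [Function.comp]
  rw [← ENNReal.ofReal_sum_of_nonneg fun j _ => h0 j, EReal.coe_ennreal_ofReal,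
    max_eq_left (Finset.sum_nonneg fun j _ => h0 j)]

theorem wiltonPartialSum_eq (x : ℝ) (n : ℕ) : wiltonPartialSum x n =
    (∑ j ∈ Finset.range n, if j.bodd = false then cfTerm gaussMap x j else 0) -
      ∑ j ∈ Finset.range n, if j.bodd = true then cfTerm gaussMap x j else 0 := by
  rw [wiltonPartialSum, ← Finset.sum_sub_distrib]
  refine Finset.sum_congr rfl fun j _ => ?_
  rcases Nat.even_or_odd j with h | h
  · have : j.bodd = false := by
      have := Nat.mod_two_of_bodd j
      cases hj : j.bodd <;> simp_all [Nat.even_iff]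
    simp [h.neg_one_pow, this]
  · have : j.bodd = true := by
      have := Nat.mod_two_of_bodd j
      cases hj : j.bodd <;> simp_all [Nat.odd_iff]
    simp [h.neg_one_pow, this]

theorem isWiltonValue_sub {x : ℝ} (hx : Irrational x)
    (h : brjunoPart false x ≠ ⊤ ∨ brjunoPart true x ≠ ⊤) :
    IsWiltonValue x ((brjunoPart false x : EReal) - (brjunoPart true x : EReal)) := by
  have h1 := tendsto_partialSum_brjunoPart false hx
  have h2 := (continuous_neg.tendsto _).comp (tendsto_partialSum_brjunoPart true hx)
  -- Addition is continuous away from `∞ - ∞`, which finiteness of one part excludes.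
  have hc : ContinuousAt (fun p : EReal × EReal => p.1 + p.2)
      ((brjunoPart false x : EReal), -(brjunoPart true x : EReal)) := by
    refine EReal.continuousAt_add ?_ ?_
    · rcases h with h | h
      · exact Or.inl (by simpa using h)
      · exact Or.inr (by simpa using h)
    · exact Or.inl (by simp)
  rw [IsWiltonValue, sub_eq_add_neg]
  refine (hc.tendsto.comp (h1.prodMk_nhds h2)).congr fun n => ?_
  simp only [Function.comp]
  rw [wiltonPartialSum_eq, sub_eq_add_neg, EReal.coe_add, EReal.coe_neg]

theorem distLE_add_right {a r : ℝ≥0∞} {C : ℝ} (hC : 0 ≤ C) (hr : r ≤ ENNReal.ofReal C) :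
    DistLE (a : EReal) ((a + r : ℝ≥0∞) : EReal) C := by
  have hr' : r ≠ ⊤ := ne_top_of_le_ne_top ENNReal.ofReal_ne_top hr
  lift r to NNReal using hr'
  rcases eq_or_ne a ⊤ with rfl | ha
  · exact Or.inr (Or.inl (by simp))
  · lift a to NNReal using ha
    refine Or.inl ⟨a, (a + r : NNReal), rfl, rfl, ?_⟩
    have : (r : ℝ) ≤ C := (NNReal.coe_le_coe.2 (ENNReal.coe_le_coe.1 hr)).trans_eq
      (Real.coe_toNNReal C hC)
    push_cast
    rw [abs_le]
    constructor <;> linarith [r.coe_nonneg]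

/-- In the finite case the two sides differ by `s - r`. -/
theorem distLE_sub {a b r s : ℝ≥0∞} {C : ℝ} (hC : 0 ≤ C) (h : s + r ≤ ENNReal.ofReal C)
    (hab : a ≠ ⊤ ∨ b ≠ ⊤) :
    DistLE ((a : EReal) - (b : EReal)) (((a + r : ℝ≥0∞) : EReal) - ((b + s : ℝ≥0∞) : EReal)) C := by
  have hr' : r ≠ ⊤ := ne_top_of_le_ne_top ENNReal.ofReal_ne_top (le_add_self.trans h)
  have hs' : s ≠ ⊤ := ne_top_of_le_ne_top ENNReal.ofReal_ne_top (le_self_add.trans h)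
  lift r to NNReal using hr'
  lift s to NNReal using hs'
  rcases eq_or_ne a ⊤ with rfl | ha
  · have hb : b ≠ ⊤ := hab.resolve_left (by simp)
    lift b to NNReal using hb
    refine Or.inr (Or.inl ⟨?_, ?_⟩)
    · exact EReal.top_sub_coe (b : ℝ)
    · rw [top_add]
      exact EReal.top_sub_coe ((b + s : NNReal) : ℝ)
  lift a to NNReal using ha
  rcases eq_or_ne b ⊤ with rfl | hb
  · refine Or.inr (Or.inr ⟨?_, ?_⟩)
    · exact EReal.sub_top (a : ℝ)
    · rw [top_add]
      exact EReal.sub_top ((a + r : NNReal) : ℝ)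
  lift b to NNReal using hb
  refine Or.inl ⟨a - b, (a + r : NNReal) - (b + s : NNReal), rfl, rfl, ?_⟩
  have : ((s + r : NNReal) : ℝ) ≤ C := (NNReal.coe_le_coe.2 (ENNReal.coe_le_coe.1
    (by rwa [ENNReal.coe_add]))).trans_eq (Real.coe_toNNReal C hC)
  push_cast at this
  push_cast
  rw [abs_le]
  constructor <;> linarith [r.coe_nonneg, s.coe_nonneg]

theorem wiltonPartialSum_fract (x : ℝ) : wiltonPartialSum (Int.fract x) = wiltonPartialSum x := by
  funext n
  simp [wiltonPartialSum, cfTerm_fract]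

theorem theorem1 :
    (∃ Cp : ℝ, ∀ x : ℝ, Irrational x →
      DistLE (brjuno x : EReal) (2 * semiBrjunoEven x) Cp) ∧
    (∃ Cm : ℝ, ∀ x : ℝ, Irrational x → ¬ (semiBrjuno x = ⊤ ∧ semiBrjuno (-x) = ⊤) →
      ∃ w : EReal, IsWiltonValue x w ∧ DistLE w (2 * semiBrjunoOdd x) Cm) := by
  refine ⟨⟨8, fun x hx => ?_⟩, ⟨8, fun x hx hfin => ?_⟩⟩
  · have hy := unitIrrational_fract hx
    rw [semiBrjunoEven, two_mul_div_two, semiBrjuno_neg hx, ← semiBrjuno_fract x, ← brjuno_fract x,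
      hy.semiBrjuno_eq, hy.semiBrjuno_one_sub_eq, mixedSum_eq, mixedSum_eq, brjuno_eq_add,
      ← EReal.coe_ennreal_add, Bool.not_false, Bool.not_true, add_add_add_comm]
    exact distLE_add_right (by norm_num) (by rw [add_comm]; exact hy.defectPart_add_le)
  · have hy := unitIrrational_fract hx
    rw [semiBrjuno_neg hx, ← semiBrjuno_fract x, hy.semiBrjuno_eq, hy.semiBrjuno_one_sub_eq,
      mixedSum_eq, mixedSum_eq] at hfin
    -- Two infinite parts would make both mixed sums infinite.
    have hne : brjunoPart false (Int.fract x) ≠ ⊤ ∨ brjunoPart true (Int.fract x) ≠ ⊤ := by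
      by_contra! h
      exact hfin (by simp [h])
    refine ⟨(brjunoPart false (Int.fract x) : EReal) - (brjunoPart true (Int.fract x) : EReal),
      ?_, ?_⟩
    · have := isWiltonValue_sub hy.1 hne
      rwa [IsWiltonValue, wiltonPartialSum_fract] at this
    · rw [semiBrjunoOdd, two_mul_div_two, semiBrjuno_neg hx, ← semiBrjuno_fract x,
        hy.semiBrjuno_eq, hy.semiBrjuno_one_sub_eq, mixedSum_eq, mixedSum_eq]
      exact distLE_sub (by norm_num) hy.defectPart_add_le hne
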